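/- Conventions. Let $M$ be a monoid. It is \emph{atomic} if there is a function $\nu:M\to\mathbb N$ with $\nu(a)=0\iff a=1$ and $\nu(ab)\ge\nu(a)+\nu(b)$ for all $a,b$. An \emph{atom} is an element $a\neq 1$ such that $a=bc$ implies $b=1$ or $c=1$. Write $a\le_L b$ if $ac=b$ for some $c\in M$, and $a\le_R b$ if $ca=b$ for some $c\in M$; put $L(a)=\{x: x\le_L a\}$ and $R(a)=\{x: x\le_R a\}$. A \emph{Garside monoid} is a monoid $M$ that is atomic, finitely generated and (left and right) cancellative, such that $(M,\le_L)$ and $(M,\le_R)$ are lattices, and that has an element $\Delta$ such that $L(\Delta)$ generates $M$ and $L(\Delta)=R(\Delta)$. Let $S$ be a finite set, $S^*$ the free monoid of words on $S$, and $\epsilon$ the empty word. A \emph{complement} on $S$ is a function $f:S\times S\to S^*$ with $f(x,x)=\epsilon$ for all $x\in S$. It defines the monoids $$M_L^f=\langle S\mid x f(x,y)=y f(y,x)\ (x,y\in S)\rangle^+,\qquad M_R^f=\langle S\mid f(y,x)x=f(x,y)y\ (x,y\in S)\rangle^+,$$ and $\equiv_L^f$, $\equiv_R^f$ denote equality in $M_L^f$,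 $M_R^f$ of the elements represented by two words. A word on $S\cup S^{-1}$ is \emph{reversible on the left} to another, written $\to_L^f$, if finitely many (possibly zero) replacements of a subword $x^{-1}y$ ($x,y\in S$) by $f(x,y)f(y,x)^{-1}$ lead from the first to the second; it is \emph{reversible on the right}, written $\to_R^f$, if the same holds with replacements of a subword $yx^{-1}$ by $f(x,y)^{-1}f(y,x)$. For $u,v\in S^*$, if $u^{-1}v\to_L^f u'(v')^{-1}$ with $u',v'\in S^*$, then $u',v'$ are unique and one puts $C_L^f(u,v)=u'$; if there are no such words, $C_L^f(u,v)=\infty$. Likewise, if $vu^{-1}\to_R^f (u')^{-1}v'$ with $u',v'\in S^*$, then one puts $C_R^f(u,v)=u'$, and $C_R^f(u,v)=\infty$ if there are no such words. The complement $f$ is \emph{coherent on the left} if for all $x,y,z\in S$ with $C_L^f(f(x,y),f(x,z))\ne\infty$ one has $C_L^f(f(y,x),f(y,z))\neq\infty$ and $$C_L^f(f(x,y),f(x,z))\equiv_L^f C_L^f(f(y,x),f(y,z)),$$ and \emph{coherent on the right} if for all $x,y,z\in S$ with $C_R^f(f(z,x),f(y,x))\ne\infty$ one has $C_R^f(f(z,y),f(x,y))\neq\infty$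 and $$C_R^f(f(z,x),f(y,x))\equiv_R^f C_R^f(f(z,y),f(x,y)).$$ \textbf{Criterion.} Let $M$ be a monoid. Then $M$ is a Garside monoid if and only if the following three conditions hold: (C1) $M$ is finitely generated and atomic; (C2) there exist finite sets $S_1,S_2$, a complement $f:S_1\times S_1\to S_1^*$ that is coherent on the left, and a complement $g:S_2\times S_2\to S_2^*$ that is coherent on the right, such that $M\cong M_L^f$ and $M\cong M_R^g$; (C3) there is an element $\Delta\in M$ such that every atom of $M$ left divides $\Delta$ and $L(\Delta)=R(\Delta)$. -/

import Mathlib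

universe u

namespace Garside

section Monoids

variable {M : Type u} [Monoid M]

/-- A norm on a monoid: it vanishes exactly at `1` and is superadditive. -/
structure IsNorm (ν : M → ℕ) : Prop where
  eq_zero_iff : ∀ a, ν a = 0 ↔ a = 1
  add_le_mul : ∀ a b, ν a + ν b ≤ ν (a * b)

variable (M) in
/-- A monoid is atomic if it carries a norm. -/
def IsAtomicMonoid : Prop := ∃ ν : M → ℕ, IsNorm ν

/-- An atom is an indecomposable element different from `1`. -/
def IsMonoidAtom (a : M) : Prop := a ≠ 1 ∧ ∀ b c : M, a = b * c → b = 1 ∨ c = 1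

/-- Left divisibility. -/
def LeftLE (a b : M) : Prop := ∃ c, a * c = b

/-- Right divisibility. -/
def RightLE (a b : M) : Prop := ∃ c, c * a = b

/-- The set `L(a)` of left divisors of `a`. -/
def leftDivisors (a : M) : Set M := {x | LeftLE x a}

/-- The set `R(a)` of right divisors of `a`. -/
def rightDivisors (a : M) : Set M := {x | RightLE x a}

end Monoids

/-- The set `X`, ordered by the relation `r`, is a lattice: `r` is a partial order and every pair of
elements has a least upper bound and a greatest lower bound. -/
structure IsLatticeRel {X : Type u} (r : X → X → Prop) : Prop where
  refl : ∀ a, r a a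
  trans : ∀ a b c, r a b → r b c → r a c
  antisymm : ∀ a b, r a b → r b a → a = b
  exists_lub : ∀ a b, ∃ s, r a s ∧ r b s ∧ ∀ c, r a c → r b c → r s c
  exists_glb : ∀ a b, ∃ i, r i a ∧ r i b ∧ ∀ c, r c a → r c b → r c i

/-- Garside monoids. -/
structure IsGarsideMonoid (M : Type u) [Monoid M] : Prop where
  atomic : IsAtomicMonoid M
  fg : Monoid.FG M
  cancel : IsCancelMul M
  left_lattice : IsLatticeRel (LeftLE (M := M))
  right_lattice : IsLatticeRel (RightLE (M := M))
  exists_garside : ∃ Δ : M,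
    Submonoid.closure (leftDivisors Δ) = ⊤ ∧ leftDivisors Δ = rightDivisors Δ

/-- A complement on `S`: a map `f : S × S → S*`, written in curried form, with `f(x,x)` empty.
The monoid `S*` of words is `FreeMonoid S`, whose unit is the empty word. -/
structure WordComplement (S : Type u) where
  toFun : S → S → FreeMonoid S
  self : ∀ x, toFun x x = 1

namespace WordComplement

variable {S : Type u} (f : WordComplement S)

/-- The defining relations `x f(x,y) = y f(y,x)`. -/
inductive LeftRel : FreeMonoid S → FreeMonoid S → Prop
  | mk (x y : S) :
      LeftRel (FreeMonoid.of x * f.toFun x y) (FreeMonoid.of y * f.toFun y x)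

/-- The defining relations `f(y,x) x = f(x,y) y`. -/
inductive RightRel : FreeMonoid S → FreeMonoid S → Prop
  | mk (x y : S) :
      RightRel (f.toFun y x * FreeMonoid.of x) (f.toFun x y * FreeMonoid.of y)

/-- The monoid `⟨S | x f(x,y) = y f(y,x)⟩⁺`. -/
abbrev LeftMonoid : Type u := PresentedMonoid f.LeftRel

/-- The monoid `⟨S | f(y,x) x = f(x,y) y⟩⁺`. -/
abbrev RightMonoid : Type u := PresentedMonoid f.RightRel

/-- The words `v` and `w` represent the same element of `LeftMonoid`. -/
def LeftEquiv (v w : FreeMonoid S) : Prop :=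
  PresentedMonoid.mk f.LeftRel v = PresentedMonoid.mk f.LeftRel w

/-- The words `v` and `w` represent the same element of `RightMonoid`. -/
def RightEquiv (v w : FreeMonoid S) : Prop :=
  PresentedMonoid.mk f.RightRel v = PresentedMonoid.mk f.RightRel w

end WordComplement

/-- Words on `S ∪ S⁻¹`: the letter `(x, true)` is `x` and the letter `(x, false)` is `x⁻¹`. -/
abbrev SignedWord (S : Type u) : Type u := FreeMonoid (S × Bool)

/-- The word `w` on `S`, as a word on `S ∪ S⁻¹`. -/
def posWord {S : Type u} (w : FreeMonoid S) : SignedWord S :=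
  FreeMonoid.map (fun x => (x, true)) w

/-- The formal inverse `w⁻¹` of the word `w` on `S`, as a word on `S ∪ S⁻¹`. -/
def negWord {S : Type u} (w : FreeMonoid S) : SignedWord S :=
  (FreeMonoid.map (fun x => (x, false)) w).reverse

namespace WordComplement

variable {S : Type u} (f : WordComplement S)

/-- One step of left reversing: a subword `x⁻¹ y` is replaced by `f(x,y) f(y,x)⁻¹`. -/
inductive LeftStep : SignedWord S → SignedWord S → Prop
  | mk (p q : SignedWord S) (x y : S) :
      LeftStep (p * (FreeMonoid.of (x, false) * FreeMonoid.of (y, true)) * q)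
        (p * (posWord (f.toFun x y) * negWord (f.toFun y x)) * q)

/-- One step of right reversing: a subword `y x⁻¹` is replaced by `f(x,y)⁻¹ f(y,x)`. -/
inductive RightStep : SignedWord S → SignedWord S → Prop
  | mk (p q : SignedWord S) (x y : S) :
      RightStep (p * (FreeMonoid.of (y, true) * FreeMonoid.of (x, false)) * q)
        (p * (negWord (f.toFun x y) * posWord (f.toFun y x)) * q)

/-- `w` is reversible on the left to `w'`, in some number of steps. -/
def LeftReverses (w w' : SignedWord S) : Prop := Relation.ReflTransGen f.LeftStep w w'

/-- `w` is reversible on the right to `w'`, in some number of steps. -/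
def RightReverses (w w' : SignedWord S) : Prop := Relation.ReflTransGen f.RightStep w w'

/-- `f.IsLeftC u v c` says that `C_L(u,v)` is finite and equal to the word `c`: the word `u⁻¹ v` is
reversible on the left to `c d⁻¹` for some word `d` (which is then `C_L(v,u)`).
By confluence of reversing there is at most one such `c`. -/
def IsLeftC (u v c : FreeMonoid S) : Prop :=
  ∃ d : FreeMonoid S, f.LeftReverses (negWord u * posWord v) (posWord c * negWord d)

/-- `f.IsRightC u v c` says that `C_R(u,v)` is finite and equal to the word `c`: the word `v u⁻¹` is
reversible on the right to `c⁻¹ d` for some word `d` (which is then `C_R(v,u)`).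
By confluence of reversing there is at most one such `c`. -/
def IsRightC (u v c : FreeMonoid S) : Prop :=
  ∃ d : FreeMonoid S, f.RightReverses (posWord v * negWord u) (negWord c * posWord d)

/-- Coherence on the left: if `C_L(f(x,y), f(x,z))` is finite, then so is `C_L(f(y,x), f(y,z))`,
and the two words represent the same element of `LeftMonoid`. -/
def LeftCoherent : Prop :=
  ∀ (x y z : S) (c : FreeMonoid S), f.IsLeftC (f.toFun x y) (f.toFun x z) c →
    ∃ c', f.IsLeftC (f.toFun y x) (f.toFun y z) c' ∧ f.LeftEquiv c c'

/-- Coherence on the right: if `C_R(f(z,x), f(y,x))` is finite, then so is `C_R(f(z,y), f(x,y))`,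
and the two words represent the same element of `RightMonoid`. -/
def RightCoherent : Prop :=
  ∀ (x y z : S) (c : FreeMonoid S), f.IsRightC (f.toFun z x) (f.toFun y x) c →
    ∃ c', f.IsRightC (f.toFun z y) (f.toFun x y) c' ∧ f.RightEquiv c c'

end WordComplement

end Garside

/-! From the conditions to a Garside monoid: reversing `a⁻¹ b` to `c d⁻¹` always gives a common
right multiple `a c = b d`, since each step applies a defining relation (`LeftReverses.mk_eq`). The
substance is the converse (`reversesBelow`): under coherence and with a norm, whenever `a` and `b`
have a common multiple, reversing terminates and every common multiple factors through its result.
By induction on the norm, this reduces to two letters (`ReversesBelow.letters`): an equality `x u =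
y v` is a chain of relations, and coherence composes the links of the chain. Since `f(x,x)` is
empty, left cancellation follows; since reversing has only one possible result, so do least common
multiples. Common multiples exist because every element divides a power of `Δ`, and greatest common
divisors are common divisors of maximal norm. Reading words backwards turns right statements into
left statements about the opposite monoid.

From a Garside monoid to the conditions: the nontrivial divisors of `Δ` are finitely many
generators, and `L(Δ) = R(Δ)` makes them, together with `1`, closed under `x, y ↦ x⁻¹ lcm(x,y)`.
This gives a complement whose values have length at most one. It is coherent because `lcm(x,y,z)` is
symmetric (`IsLatticeRel.compl_compl`), and norm induction shows that it presents the monoid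
(`IsLatticeRel.wordProd_eq_iff`). -/

namespace Garside

/-! ### Positive and signed words -/

section Words

variable {S : Type u}

theorem of_mul_ne_one (x : S) (u : FreeMonoid S) : FreeMonoid.of x * u ≠ 1 :=
  List.cons_ne_nil x u

theorem of_mul_inj {x y : S} {u v : FreeMonoid S}
    (h : FreeMonoid.of x * u = FreeMonoid.of y * v) : x = y ∧ u = v :=
  List.cons.inj h

theorem eq_one_or_eq_of_mul (u : FreeMonoid S) : u = 1 ∨ ∃ x v, u = FreeMonoid.of x * v := by
  induction u using FreeMonoid.casesOn with
  | one => exact Or.inl rfl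
  | of_mul x v => exact Or.inr ⟨x, v, rfl⟩

@[simp] theorem posWord_one : posWord (1 : FreeMonoid S) = 1 := rfl

@[simp] theorem negWord_one : negWord (1 : FreeMonoid S) = 1 := rfl

@[simp] theorem posWord_of (x : S) : posWord (FreeMonoid.of x) = FreeMonoid.of (x, true) := rfl

@[simp] theorem negWord_of (x : S) : negWord (FreeMonoid.of x) = FreeMonoid.of (x, false) := rfl

theorem posWord_mul (u v : FreeMonoid S) : posWord (u * v) = posWord u * posWord v :=
  map_mul _ u v

theorem negWord_mul (u v : FreeMonoid S) : negWord (u * v) = negWord v * negWord u := by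
  simp [negWord, FreeMonoid.reverse_mul]

theorem reverse_posWord (u : FreeMonoid S) : (posWord u).reverse = posWord u.reverse :=
  List.map_reverse.symm

theorem reverse_negWord (u : FreeMonoid S) : (negWord u).reverse = negWord u.reverse := by
  refine congrArg FreeMonoid.reverse ?_
  exact List.map_reverse.symm

/-- The formal inverse of a signed word. -/
def invWord (w : SignedWord S) : SignedWord S :=
  (FreeMonoid.map (fun x => (x.1, !x.2)) w).reverse

theorem invWord_mul (v w : SignedWord S) : invWord (v * w) = invWord w * invWord v := by
  simp [invWord, FreeMonoid.reverse_mul]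

theorem invWord_posWord (u : FreeMonoid S) : invWord (posWord u) = negWord u := by
  simp [invWord, posWord, negWord, FreeMonoid.map_map, Function.comp_def]

theorem invWord_negWord (u : FreeMonoid S) : invWord (negWord u) = posWord u := by
  have h : invWord (invWord (posWord u)) = posWord u := by
    change List.reverse (List.map _ (List.reverse (List.map _ _))) = _
    rw [List.map_reverse, List.reverse_reverse, List.map_map]
    exact (List.map_congr_left (by simp)).trans (List.map_id _)
  rwa [invWord_posWord] at h

/-- The word formed by the letters of a signed word that carry the given sign. -/
def signPart (b : Bool) : SignedWord S →* FreeMonoid S :=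
  FreeMonoid.lift fun x => if x.2 = b then FreeMonoid.of x.1 else 1

theorem signPart_posWord (b : Bool) (u : FreeMonoid S) :
    signPart b (posWord u) = if b then u else 1 := by
  induction u using FreeMonoid.inductionOn' with
  | one => simp
  | of_mul x u ih => rw [posWord_mul, map_mul, ih]; cases b <;> simp [signPart]

theorem signPart_negWord (b : Bool) (u : FreeMonoid S) :
    signPart b (negWord u) = if b then 1 else u.reverse := by
  induction u using FreeMonoid.inductionOn' with
  | one => cases b <;> rfl
  | of_mul x u ih =>
    rw [negWord_mul, map_mul, ih]
    cases b <;> simp [signPart, FreeMonoid.reverse_mul, FreeMonoid.reverse_of]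

theorem posWord_mul_negWord_inj {c d c' d' : FreeMonoid S}
    (h : posWord c * negWord d = posWord c' * negWord d') : c = c' ∧ d = d' := by
  constructor
  · simpa [signPart_posWord, signPart_negWord] using congrArg (signPart true) h
  · simpa [signPart_posWord, signPart_negWord, FreeMonoid.reverse_reverse] using
      congrArg (fun w => (signPart false w).reverse) h

end Words

namespace WordComplement

variable {S : Type u} (f : WordComplement S)

/-! ### Confluence of left reversing -/

section Reversing

variable {f}

theorem LeftStep.mul_mul {w w' : SignedWord S} (h : f.LeftStep w w') (p q : SignedWord S) :
    f.LeftStep (p * w * q) (p * w' * q) := by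
  obtain ⟨p', q', x, y⟩ := h
  simpa only [mul_assoc] using LeftStep.mk (f := f) (p * p') (q' * q) x y

theorem LeftReverses.mul_mul {w w' : SignedWord S} (h : f.LeftReverses w w')
    (p q : SignedWord S) : f.LeftReverses (p * w * q) (p * w' * q) :=
  Relation.ReflTransGen.lift (fun w => p * w * q) (fun _ _ h => LeftStep.mul_mul h p q) _ _ h

theorem LeftStep.invWord {w w' : SignedWord S} (h : f.LeftStep w w') :
    f.LeftStep (invWord w) (invWord w') := by
  obtain ⟨p, q, x, y⟩ := h
  have := LeftStep.mk (f := f) (Garside.invWord q) (Garside.invWord p) y x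
  simpa only [← posWord_of, ← negWord_of, invWord_mul, invWord_posWord, invWord_negWord,
    mul_assoc] using this

/-- Formal inversion sends `x⁻¹ y` to `y⁻¹ x` and its replacement to the matching replacement, so it
preserves reversing. -/
theorem LeftReverses.swap {a b c d : FreeMonoid S}
    (h : f.LeftReverses (negWord a * posWord b) (posWord c * negWord d)) :
    f.LeftReverses (negWord b * posWord a) (posWord d * negWord c) := by
  have := Relation.ReflTransGen.lift (p := f.LeftStep) Garside.invWord
    (fun _ _ h => LeftStep.invWord h) _ _ h
  simpa only [Function.onFun, invWord_mul, invWord_posWord, invWord_negWord, LeftReverses]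
    using this

variable (f) in
theorem leftReverses_letters (x y : S) :
    f.LeftReverses (FreeMonoid.of (x, false) * FreeMonoid.of (y, true))
      (posWord (f.toFun x y) * negWord (f.toFun y x)) :=
  Relation.ReflTransGen.single (by simpa using LeftStep.mk (f := f) 1 1 x y)

/-- In `c d⁻¹` no positive letter comes after a negative one, whereas a reducible subword `x⁻¹ y` is
exactly such a pattern. -/
theorem LeftStep.not_posWord_mul_negWord {c d : FreeMonoid S} {w : SignedWord S} :
    ¬ f.LeftStep (posWord c * negWord d) w := by
  intro h
  generalize hv : posWord c * negWord d = v at h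
  obtain ⟨p, q, x, y⟩ := h
  have hs : ∀ c d : List S, List.Pairwise (fun a b : S × Bool => b.2 = true → a.2 = true)
      (c.map (fun x => (x, true)) ++ (d.map (fun x => (x, false))).reverse) := by
    intro c d
    rw [List.pairwise_append, ← List.map_reverse, List.pairwise_map, List.pairwise_map]
    exact ⟨List.pairwise_of_forall (by simp), List.pairwise_of_forall (by simp), by simp⟩
  have ht : ∀ p q : List (S × Bool), ¬ List.Pairwise
      (fun a b : S × Bool => b.2 = true → a.2 = true) ((p ++ ([(x, false)] ++ [(y, true)])) ++ q) := by
    simp [List.pairwise_append]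
  exact ht p q ((congrArg (List.Pairwise _) hv).mp (hs c d))

/-- Two subwords of the form `x⁻¹ y` coincide or are disjoint: a one-letter overlap would be both
positive and negative. Disjoint replacements commute. -/
theorem LeftStep.diamond {w w₁ w₂ : SignedWord S} (h₁ : f.LeftStep w w₁) (h₂ : f.LeftStep w w₂) :
    ∃ v, Relation.ReflGen f.LeftStep w₁ v ∧ Relation.ReflTransGen f.LeftStep w₂ v := by
  have far : ∀ (p t q : SignedWord S) (x y x' y' : S), ∃ v,
      f.LeftStep (p * (posWord (f.toFun x y) * negWord (f.toFun y x)) *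
        (t * (FreeMonoid.of (x', false) * FreeMonoid.of (y', true) * q))) v ∧
      f.LeftStep (p * (FreeMonoid.of (x, false) * FreeMonoid.of (y, true)) *
        (t * (posWord (f.toFun x' y') * negWord (f.toFun y' x') * q))) v := by
    intro p t q x y x' y'
    refine ⟨p * (posWord (f.toFun x y) * negWord (f.toFun y x)) *
        (t * (posWord (f.toFun x' y') * negWord (f.toFun y' x') * q)), ?_, LeftStep.mk _ _ _ _⟩
    have := LeftStep.mk (f := f) (p * (posWord (f.toFun x y) * negWord (f.toFun y x)) * t) q x' y'
    simpa only [mul_assoc] using this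
  have overlap : ∀ (t r r' : List (S × Bool)) (x y x' y' : S),
      (x, false) :: (y, true) :: r = t ++ (x', false) :: (y', true) :: r' →
      (t = [] ∧ x = x' ∧ y = y' ∧ r = r') ∨
        ∃ t', t = (x, false) :: (y, true) :: t' ∧ r = t' ++ (x', false) :: (y', true) :: r' := by
    rintro (_ | ⟨a, _ | ⟨b, t⟩⟩) r r' x y x' y' h
    · simpa using h
    · simp at h
    · simp only [List.cons_append, List.cons.injEq] at h
      exact Or.inr ⟨t, by rw [h.1, h.2.1], h.2.2⟩
  obtain ⟨p, q, x, y⟩ := h₁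
  generalize hw : p * (FreeMonoid.of (x, false) * FreeMonoid.of (y, true)) * q = w at h₂
  obtain ⟨p', q', x', y'⟩ := h₂
  have happ : ∀ p q p' q' : List (S × Bool),
      (p ++ ([(x, false)] ++ [(y, true)])) ++ q = (p' ++ ([(x', false)] ++ [(y', true)])) ++ q' →
      (∃ t, p' = p ++ t ∧ (x, false) :: (y, true) :: q = t ++ (x', false) :: (y', true) :: q') ∨
      ∃ t, p = p' ++ t ∧ (x', false) :: (y', true) :: q' = t ++ (x, false) :: (y, true) :: q := by
    intro p q p' q' h
    simpa using List.append_eq_append_iff.1 (by simpa using h)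
  obtain ⟨t, hp, ht⟩ | ⟨t, hp, ht⟩ := happ _ _ _ _ hw
  · obtain ⟨rfl, rfl, rfl, rfl⟩ | ⟨t, rfl, rfl⟩ := overlap _ _ _ _ _ _ _ ht
    · obtain rfl : p' = p := hp.trans (List.append_nil p)
      exact ⟨_, .refl, .refl⟩
    · obtain ⟨v, h, h'⟩ := far p (FreeMonoid.ofList t) q' x y x' y'
      obtain rfl : p' = p * (FreeMonoid.of (x, false) * FreeMonoid.of (y, true)) *
          FreeMonoid.ofList t := by
        rw [mul_assoc]; exact hp
      refine ⟨v, .single ?_, .single ?_⟩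
      · exact h
      · simpa only [mul_assoc] using h'
  · obtain ⟨rfl, rfl, rfl, rfl⟩ | ⟨t, rfl, rfl⟩ := overlap _ _ _ _ _ _ _ ht
    · obtain rfl : p = p' := hp.trans (List.append_nil p')
      exact ⟨_, .refl, .refl⟩
    · obtain ⟨v, h, h'⟩ := far p' (FreeMonoid.ofList t) q x' y' x y
      obtain rfl : p = p' * (FreeMonoid.of (x', false) * FreeMonoid.of (y', true)) *
          FreeMonoid.ofList t := by
        rw [mul_assoc]; exact hp
      refine ⟨v, .single ?_, .single ?_⟩
      · simpa only [mul_assoc] using h'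
      · exact h

theorem LeftReverses.unique {w : SignedWord S} {c d c' d' : FreeMonoid S}
    (h : f.LeftReverses w (posWord c * negWord d))
    (h' : f.LeftReverses w (posWord c' * negWord d')) : c = c' ∧ d = d' := by
  obtain ⟨v, hv, hv'⟩ := Relation.church_rosser (fun _ _ _ => LeftStep.diamond) h h'
  have terminal : ∀ {a b : FreeMonoid S},
      Relation.ReflTransGen f.LeftStep (posWord a * negWord b) v → posWord a * negWord b = v := by
    intro a b hab
    obtain hab | ⟨u, hu, -⟩ := hab.cases_head
    · exact hab
    · exact (LeftStep.not_posWord_mul_negWord hu).elim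
  exact posWord_mul_negWord_inj ((terminal hv).trans (terminal hv').symm)

theorem IsLeftC.unique {u v c c' : FreeMonoid S} (h : f.IsLeftC u v c) (h' : f.IsLeftC u v c') :
    c = c' := by
  obtain ⟨d, hd⟩ := h
  obtain ⟨d', hd'⟩ := h'
  exact (LeftReverses.unique hd hd').1

end Reversing

/-! ### Soundness of reversing -/

/-- The class of a word in the monoid presented by the left relations. -/
abbrev leftMk : FreeMonoid S →* f.LeftMonoid := PresentedMonoid.mk f.LeftRel

/-- A signed word, read as a relation between elements of the monoid: the letter `x` relates `x b`
to `b`, and the letter `x⁻¹` relates `a` to `x a`. -/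
def Traces : List (S × Bool) → f.LeftMonoid → f.LeftMonoid → Prop
  | [], a, b => a = b
  | (x, true) :: w, a, b => ∃ a', a = f.leftMk (FreeMonoid.of x) * a' ∧ Traces w a' b
  | (x, false) :: w, a, b => Traces w (f.leftMk (FreeMonoid.of x) * a) b

theorem traces_mul (v w : SignedWord S) (a b : f.LeftMonoid) :
    f.Traces (v * w) a b ↔ ∃ c, f.Traces v a c ∧ f.Traces w c b := by
  induction v using FreeMonoid.inductionOn' generalizing a with
  | one => simp [show f.Traces (1 : SignedWord S) = fun a b => a = b from rfl]
  | of_mul x v ih =>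
    obtain ⟨x, _ | _⟩ := x
    · exact ih _
    · constructor
      · rintro ⟨a', rfl, h⟩
        obtain ⟨c, hc, hc'⟩ := (ih a').1 h
        exact ⟨c, ⟨a', rfl, hc⟩, hc'⟩
      · rintro ⟨c, ⟨a', rfl, hc⟩, hc'⟩
        exact ⟨a', rfl, (ih a').2 ⟨c, hc, hc'⟩⟩

theorem traces_posWord (u : FreeMonoid S) (a b : f.LeftMonoid) :
    f.Traces (posWord u) a b ↔ a = f.leftMk u * b := by
  induction u using FreeMonoid.inductionOn' generalizing a with
  | one => simp [show f.Traces (1 : SignedWord S) = fun a b => a = b from rfl]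
  | of_mul x u ih =>
    rw [posWord_mul, traces_mul, map_mul, mul_assoc]
    simp [ih, Traces, show ∀ x, f.Traces (FreeMonoid.of x) = f.Traces [x] from fun _ => rfl]

theorem traces_negWord (u : FreeMonoid S) (a b : f.LeftMonoid) :
    f.Traces (negWord u) a b ↔ f.leftMk u * a = b := by
  induction u using FreeMonoid.inductionOn' generalizing b with
  | one => simp [show f.Traces (1 : SignedWord S) = fun a b => a = b from rfl]
  | of_mul x u ih =>
    rw [negWord_mul, traces_mul, map_mul, mul_assoc]
    simp [ih, Traces, show ∀ x, f.Traces (FreeMonoid.of x) = f.Traces [x] from fun _ => rfl]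

theorem leftMk_rel (x y : S) : f.leftMk (FreeMonoid.of x) * f.leftMk (f.toFun x y) =
    f.leftMk (FreeMonoid.of y) * f.leftMk (f.toFun y x) := by
  simpa only [map_mul] using PresentedMonoid.mk_eq_mk_of_rel (LeftRel.mk (f := f) x y)

variable {f}

/-- Signed words act as relations because the monoid is not known to be cancellative. For one step,
`a = f(x,y) e` and `b = f(y,x) e` give `x a = y b`; only this direction holds in general. -/
theorem LeftReverses.traces {w w' : SignedWord S} (h : f.LeftReverses w w') {a b : f.LeftMonoid}
    (ht : f.Traces w' a b) : f.Traces w a b := by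
  induction h with
  | refl => exact ht
  | tail _ hs ih =>
    obtain ⟨p, q, x, y⟩ := hs
    refine ih ?_
    simp only [← posWord_of, ← negWord_of, traces_mul, traces_posWord, traces_negWord] at ht ⊢
    obtain ⟨c, ⟨d, hd, e, rfl, rfl⟩, hc⟩ := ht
    exact ⟨_, ⟨_, hd, _, rfl, by rw [← mul_assoc, leftMk_rel, mul_assoc]⟩, hc⟩

/-- The words computed by reversing `a⁻¹ b` complete `a` and `b` to a common multiple. -/
theorem LeftReverses.mk_eq {a b c d : FreeMonoid S}
    (h : f.LeftReverses (negWord a * posWord b) (posWord c * negWord d)) :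
    f.leftMk a * f.leftMk c = f.leftMk b * f.leftMk d := by
  obtain ⟨m, hm, hm'⟩ := (f.traces_mul _ _ _ _).1 <| h.traces <| (f.traces_mul _ _ _ _).2
    ⟨1, (f.traces_posWord c _ _).2 rfl, (f.traces_negWord d _ _).2 rfl⟩
  rw [traces_negWord] at hm
  rw [traces_posWord] at hm'
  simpa using hm.trans hm'

end WordComplement

/-! ### Norm estimates -/

namespace IsNorm

variable {M : Type u} [Monoid M] {ν : M → ℕ} (hν : IsNorm ν)
include hν

theorem pos {a : M} (ha : a ≠ 1) : 0 < ν a :=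
  Nat.pos_of_ne_zero fun h => ha ((hν.eq_zero_iff a).1 h)

theorem le_mul_left (a b : M) : ν b ≤ ν (a * b) :=
  le_trans (Nat.le_add_left _ _) (hν.add_le_mul a b)

theorem le_mul_right (a b : M) : ν a ≤ ν (a * b) :=
  le_trans (Nat.le_add_right _ _) (hν.add_le_mul a b)

theorem lt_mul_left {a : M} (ha : a ≠ 1) (b : M) : ν b < ν (a * b) := by
  have := hν.add_le_mul a b
  have := hν.pos ha
  omega

theorem eq_one_of_mul_le {a b : M} (h : ν (a * b) ≤ ν a) : b = 1 := by
  have := hν.add_le_mul a b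
  exact (hν.eq_zero_iff b).1 (by omega)

end IsNorm

/-! ### Completeness of reversing for a coherent complement -/

namespace WordComplement

variable {S : Type u} {f : WordComplement S}

/-- Both sides of every defining relation are nonempty, so the empty word is congruent only to
itself. -/
theorem leftMk_eq_one {w : FreeMonoid S} (h : f.leftMk w = 1) : w = 1 := by
  have key : ∀ a b, ConGen.Rel f.LeftRel a b → (a = 1 ↔ b = 1) := by
    intro a b hab
    induction hab with
    | of _ _ h =>
      obtain ⟨x, y⟩ := h
      simp
    | refl => rfl
    | symm _ ih => exact ih.symm
    | trans _ _ ih ih' => exact ih.trans ih'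
    | mul _ _ ih ih' =>
      have h1 : ∀ a b : FreeMonoid S, a * b = 1 ↔ a = 1 ∧ b = 1 := fun a b =>
        List.append_eq_nil_iff
      rw [h1, h1, ih, ih']
  exact (key w 1 (PresentedMonoid.mk_eq_mk_iff.1 (h.trans (map_one _).symm))).2 rfl

theorem leftMk_of_ne_one (x : S) : f.leftMk (FreeMonoid.of x) ≠ 1 := fun h =>
  FreeMonoid.of_ne_one x (leftMk_eq_one h)

variable (f) in
/-- For all words `a` and `b` with a common right multiple `m` such that `ν m < n`, reversing
`a⁻¹ b` terminates, and `m` is a multiple of the common multiple that it yields. -/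
def ReversesBelow (ν : f.LeftMonoid → ℕ) (n : ℕ) : Prop :=
  ∀ (a b : FreeMonoid S) (p q : f.LeftMonoid), f.leftMk a * p = f.leftMk b * q →
    ν (f.leftMk a * p) < n → ∃ (c d : FreeMonoid S) (r : f.LeftMonoid),
      f.LeftReverses (negWord a * posWord b) (posWord c * negWord d) ∧
      p = f.leftMk c * r ∧ q = f.leftMk d * r

/-- Transitivity step: if `x u = z t = y v` and the common multiples `z t` of `x, z` and of `z, y`
factor through the complements, then so does the common multiple of `x, y`. -/
theorem ReversesBelow.letters_trans {ν : f.LeftMonoid → ℕ} (hf : f.LeftCoherent) {n : ℕ}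
    (h : f.ReversesBelow ν n) {x y z : S} {u t v p q : f.LeftMonoid} (ht : ν t < n)
    (hu : u = f.leftMk (f.toFun x z) * p) (htp : t = f.leftMk (f.toFun z x) * p)
    (htq : t = f.leftMk (f.toFun z y) * q) (hv : v = f.leftMk (f.toFun y z) * q) :
    ∃ r, u = f.leftMk (f.toFun x y) * r ∧ v = f.leftMk (f.toFun y x) * r := by
  obtain ⟨c, c', r, hc, rfl, rfl⟩ := h _ _ _ _ (htp.symm.trans htq) (htp ▸ ht)
  -- Coherence is used on three faces of the cube on `x, y, z`. The first two give `f(x,z) e =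
  -- f(x,y) e'` and `f(y,z) g = f(y,x) g'` with `e ≡ c`, `g ≡ c'`; the third gives `e' ≡ g'`, so
  -- that both quotients are the same element.
  obtain ⟨e, ⟨e', he⟩, hce⟩ := hf z x y c ⟨c', hc⟩
  obtain ⟨g, ⟨g', hg⟩, hcg⟩ := hf z y x c' ⟨c, hc.swap⟩
  obtain ⟨k, hk, hek⟩ := hf x y z e' ⟨e, he.swap⟩
  obtain rfl : g' = k := IsLeftC.unique ⟨g, hg.swap⟩ hk
  refine ⟨f.leftMk e' * r, ?_, ?_⟩
  · rw [hu, show f.leftMk c = f.leftMk e from hce, ← mul_assoc, he.mk_eq, mul_assoc]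
  · rw [hv, show f.leftMk c' = f.leftMk g from hcg, ← mul_assoc, hg.mk_eq, mul_assoc,
      show f.leftMk e' = f.leftMk g' from hek]

/-- Induction on a derivation of the congruence between the words `x u` and `y v`. All words in the
derivation have the same norm, and deleting a first letter lowers it strictly; hence the bound `≤ n`
here against `< n` in the hypothesis. -/
theorem ReversesBelow.letters {ν : f.LeftMonoid → ℕ} (hν : IsNorm ν) (hf : f.LeftCoherent) {n : ℕ}
    (h : f.ReversesBelow ν n) {x y : S} {u v : f.LeftMonoid}
    (huv : f.leftMk (FreeMonoid.of x) * u = f.leftMk (FreeMonoid.of y) * v)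
    (hn : ν (f.leftMk (FreeMonoid.of x) * u) ≤ n) :
    ∃ r, u = f.leftMk (f.toFun x y) * r ∧ v = f.leftMk (f.toFun y x) * r := by
  have key : ∀ w w', ConGen.Rel f.LeftRel w w' → ν (f.leftMk w) ≤ n →
      ∀ x u y v, w = FreeMonoid.of x * u → w' = FreeMonoid.of y * v →
      ∃ r, f.leftMk u = f.leftMk (f.toFun x y) * r ∧ f.leftMk v = f.leftMk (f.toFun y x) * r := by
    intro w w' hw
    have hmk : ∀ {w w'}, ConGen.Rel f.LeftRel w w' → f.leftMk w = f.leftMk w' := fun h =>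
      PresentedMonoid.mk_eq_mk_iff.2 h
    induction hw with
    | of _ _ h =>
      obtain ⟨x', y'⟩ := h
      intro _ x u y v hu hv
      obtain ⟨rfl, rfl⟩ := of_mul_inj hu
      obtain ⟨rfl, rfl⟩ := of_mul_inj hv
      exact ⟨1, by simp⟩
    | refl w =>
      rintro - x u y v rfl hv
      obtain ⟨rfl, rfl⟩ := of_mul_inj hv
      exact ⟨f.leftMk u, by simp [f.self]⟩
    | symm hw ih =>
      intro hn x u y v hu hv
      obtain ⟨r, hr, hr'⟩ := ih (by rwa [hmk hw]) y v x u hv hu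
      exact ⟨r, hr', hr⟩
    | @trans w₁ w₂ w₃ h₁ h₂ ih₁ ih₂ =>
      rintro hn x u y v rfl rfl
      -- The intermediate word is nonempty; its first letter `z` links `x` to `y`.
      obtain rfl | ⟨z, t, rfl⟩ := eq_one_or_eq_of_mul w₂
      · exact (of_mul_ne_one _ _ (leftMk_eq_one ((hmk h₁).trans (map_one _)))).elim
      obtain ⟨p, hu, hp⟩ := ih₁ hn x u z t rfl rfl
      rw [hmk h₁] at hn
      obtain ⟨q, hq, hv⟩ := ih₂ hn z t y v rfl rfl
      refine h.letters_trans hf (t := f.leftMk t) ?_ hu hp hq hv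
      rw [map_mul] at hn
      exact (hν.lt_mul_left (leftMk_of_ne_one z) _).trans_le hn
    | @mul a a' b b' ha hb iha ihb =>
      intro hn x u y v hu hv
      rw [map_mul] at hn
      -- The first letters lie in `a` and `a'` unless these are empty, and they are empty together;
      -- then the first letters lie in `b` and `b'`.
      obtain rfl | ⟨x', a, rfl⟩ := eq_one_or_eq_of_mul a
      · obtain rfl := leftMk_eq_one ((hmk ha).symm.trans (map_one _))
        rw [one_mul] at hu hv
        exact ihb ((hν.le_mul_left _ _).trans hn) x u y v hu hv
      obtain rfl | ⟨y', a', rfl⟩ := eq_one_or_eq_of_mul a'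
      · exact (of_mul_ne_one _ _ (leftMk_eq_one ((hmk ha).trans (map_one _)))).elim
      rw [mul_assoc] at hu hv
      obtain ⟨rfl, rfl⟩ := of_mul_inj hu
      obtain ⟨rfl, rfl⟩ := of_mul_inj hv
      obtain ⟨r, hr, hr'⟩ := iha ((hν.le_mul_right _ _).trans hn) _ _ _ _ rfl rfl
      exact ⟨r * f.leftMk b, by rw [map_mul, hr, mul_assoc], by
        rw [map_mul, hr', ← hmk hb, mul_assoc]⟩
  obtain ⟨u, rfl⟩ := PresentedMonoid.surjective_mk u
  obtain ⟨v, rfl⟩ := PresentedMonoid.surjective_mk v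
  simp only [← map_mul] at huv hn
  exact key _ _ (PresentedMonoid.mk_eq_mk_iff.1 huv) hn x u y v rfl rfl

/-- The reversing diagram of `x a` against `y b` splits into four tiles: `x` against `y`, `a`
against `f(x,y)`, `f(y,x)` against `b`, and the remaining corner. The first is handled by
`ReversesBelow.letters`; the others have common multiples of norm below `n`. -/
theorem reversesBelow {ν : f.LeftMonoid → ℕ} (hν : IsNorm ν) (hf : f.LeftCoherent) (n : ℕ) :
    f.ReversesBelow ν n := by
  induction n with
  | zero => exact fun _ _ _ _ _ h => (Nat.not_lt_zero _ h).elim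
  | succ n ih =>
    intro a b p q hpq hn
    obtain rfl | ⟨x, a, rfl⟩ := eq_one_or_eq_of_mul a
    · exact ⟨b, 1, q, by simpa using .refl, by simpa using hpq, by simp⟩
    obtain rfl | ⟨y, b, rfl⟩ := eq_one_or_eq_of_mul b
    · exact ⟨1, _, p, by simpa using .refl, by simp, by simpa using hpq.symm⟩
    rw [map_mul, mul_assoc] at hpq hn
    rw [map_mul, mul_assoc] at hpq
    replace hn := Nat.le_of_lt_succ hn
    have ha := (hν.lt_mul_left (leftMk_of_ne_one x) _).trans_le hn
    have hb := (hν.lt_mul_left (leftMk_of_ne_one y) _).trans_le (hpq ▸ hn)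
    obtain ⟨w, hp, hq⟩ := ih.letters hν hf hpq hn
    obtain ⟨c₁, d₁, r₁, h₁, rfl, rfl⟩ := ih _ _ _ _ hp ha
    obtain ⟨c₂, d₂, r₂, h₂, hw, rfl⟩ := ih _ _ _ _ hq.symm (hq ▸ hb)
    obtain ⟨c₃, d₃, r, h₃, rfl, rfl⟩ := ih _ _ _ _ hw <|
      ((hν.le_mul_left _ _).trans_eq (congrArg ν hp.symm)).trans_lt ha
    refine ⟨c₁ * c₃, d₂ * d₃, r, ?_, by rw [map_mul, mul_assoc], by rw [map_mul, mul_assoc]⟩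
    -- The four tiles, each reversed in its context, are now pasted together.
    have s₀ := (f.leftReverses_letters x y).mul_mul (negWord a) (posWord b)
    have s₁ := h₁.mul_mul 1 (negWord (f.toFun y x) * posWord b)
    have s₂ := h₂.mul_mul (posWord c₁ * negWord d₁) 1
    have s₃ := h₃.mul_mul (posWord c₁) (negWord d₂)
    simp only [posWord_mul, negWord_mul, posWord_of, negWord_of, mul_assoc, one_mul, mul_one]
      at s₀ s₁ s₂ s₃ ⊢
    exact s₀.trans (s₁.trans (s₂.trans s₃))

/-- If `f` is coherent and presents an atomic monoid, then this monoid is left cancellative. -/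
theorem LeftCoherent.mul_left_cancel (hf : f.LeftCoherent) (hM : IsAtomicMonoid f.LeftMonoid)
    {a p q : f.LeftMonoid} (h : a * p = a * q) : p = q := by
  obtain ⟨ν, hν⟩ := hM
  obtain ⟨a, rfl⟩ := PresentedMonoid.surjective_mk a
  induction a using FreeMonoid.inductionOn' with
  | one => simpa using h
  | of_mul x a ih =>
    rw [map_mul, mul_assoc, mul_assoc] at h
    obtain ⟨r, hr, hr'⟩ := (reversesBelow hν hf _).letters hν hf h le_rfl
    exact ih (hr.trans hr'.symm)

/-- If `f` is coherent and presents an atomic monoid, then two elements with a common right multiple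
have a least one. -/
theorem LeftCoherent.exists_lub (hf : f.LeftCoherent) (hM : IsAtomicMonoid f.LeftMonoid)
    {a b m : f.LeftMonoid} (ha : LeftLE a m) (hb : LeftLE b m) :
    ∃ s, LeftLE a s ∧ LeftLE b s ∧ ∀ c, LeftLE a c → LeftLE b c → LeftLE s c := by
  obtain ⟨ν, hν⟩ := hM
  obtain ⟨a, rfl⟩ := PresentedMonoid.surjective_mk a
  obtain ⟨b, rfl⟩ := PresentedMonoid.surjective_mk b
  obtain ⟨p, hp⟩ := ha
  obtain ⟨q, rfl⟩ := hb
  obtain ⟨c, d, r, h, -, -⟩ := reversesBelow hν hf _ _ _ _ _ hp (Nat.lt_succ_self _)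
  refine ⟨f.leftMk a * f.leftMk c, ⟨_, rfl⟩, ⟨_, h.mk_eq.symm⟩, ?_⟩
  rintro _ ⟨p, rfl⟩ ⟨q, hq⟩
  obtain ⟨c', d', r, h', rfl, -⟩ := reversesBelow hν hf _ _ _ _ _ hq.symm (Nat.lt_succ_self _)
  -- Reversing knows nothing of the common multiple, so every one of them factors through the same
  -- `c`.
  obtain ⟨rfl, -⟩ := h.unique h'
  exact ⟨r, mul_assoc _ _ _⟩

end WordComplement

/-! ### Left-right duality by reading words backwards -/

section Dual

open MulOpposite

theorem conGen_reverse {S : Type u} {r r' : FreeMonoid S → FreeMonoid S → Prop}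
    (h : ∀ a b, r a b → r' a.reverse b.reverse) {a b : FreeMonoid S} (hab : ConGen.Rel r a b) :
    ConGen.Rel r' a.reverse b.reverse := by
  induction hab with
  | of _ _ hr => exact .of _ _ (h _ _ hr)
  | refl => exact .refl _
  | symm _ ih => exact ih.symm
  | trans _ _ ih ih' => exact ih.trans ih'
  | mul _ _ ih ih' =>
    rw [FreeMonoid.reverse_mul, FreeMonoid.reverse_mul]
    exact ih'.mul ih

/-- This form lets a presentation be checked on words alone, both for the opposite monoid and for
the lcm complement. -/
theorem nonempty_mulEquiv_presentedMonoid_iff {S M : Type u} [Monoid M]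
    {r : FreeMonoid S → FreeMonoid S → Prop} :
    Nonempty (M ≃* PresentedMonoid r) ↔ ∃ π : FreeMonoid S →* M, Function.Surjective π ∧
      ∀ u v, π u = π v ↔ PresentedMonoid.mk r u = PresentedMonoid.mk r v := by
  constructor
  · rintro ⟨e⟩
    exact ⟨e.symm.toMonoidHom.comp (PresentedMonoid.mk r),
      e.symm.surjective.comp PresentedMonoid.surjective_mk, fun u v => e.symm.injective.eq_iff⟩
  · rintro ⟨π, hπ, h⟩
    have hl : FreeMonoid.lift (fun x => π (FreeMonoid.of x)) = π := FreeMonoid.lift_restrict π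
    have hr : ∀ a b, r a b → FreeMonoid.lift (fun x => π (FreeMonoid.of x)) a =
        FreeMonoid.lift (fun x => π (FreeMonoid.of x)) b := fun a b hab => by
      rw [hl, h]
      exact PresentedMonoid.mk_eq_mk_of_rel hab
    have hmk : ∀ u, PresentedMonoid.lift _ hr (PresentedMonoid.mk r u) = π u := fun u =>
      congrArg (fun φ : FreeMonoid S →* M => φ u) hl
    refine ⟨(MulEquiv.ofBijective (PresentedMonoid.lift _ hr) ⟨?_, ?_⟩).symm⟩
    · intro u v huv
      obtain ⟨u, rfl⟩ := PresentedMonoid.surjective_mk u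
      obtain ⟨v, rfl⟩ := PresentedMonoid.surjective_mk v
      rwa [hmk, hmk, h] at huv
    · intro a
      obtain ⟨u, rfl⟩ := hπ a
      exact ⟨_, hmk u⟩

namespace WordComplement

variable {S : Type u}

/-- The complement whose right reversing is, up to reading words backwards, the left reversing
of `f`, and vice versa. -/
def dual (f : WordComplement S) : WordComplement S where
  toFun x y := (f.toFun y x).reverse
  self x := by rw [f.self]; rfl

@[simp] theorem dual_dual (f : WordComplement S) : f.dual.dual = f := by
  obtain ⟨f, _⟩ := f
  simp [dual, FreeMonoid.reverse_reverse]

variable (f : WordComplement S)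

theorem dual_toFun (x y : S) : f.dual.toFun x y = (f.toFun y x).reverse := rfl

theorem dual_rightEquiv_iff (u v : FreeMonoid S) :
    f.dual.RightEquiv u v ↔ f.LeftEquiv u.reverse v.reverse := by
  rw [RightEquiv, LeftEquiv, PresentedMonoid.mk_eq_mk_iff, PresentedMonoid.mk_eq_mk_iff]
  constructor
  · refine conGen_reverse ?_
    rintro _ _ ⟨x, y⟩
    simpa [FreeMonoid.reverse_mul, dual_toFun, FreeMonoid.reverse_reverse, FreeMonoid.reverse_of] using
      LeftRel.mk (f := f) x y
  · intro h
    rw [← FreeMonoid.reverse_reverse (a := u), ← FreeMonoid.reverse_reverse (a := v)]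
    refine conGen_reverse ?_ h
    rintro _ _ ⟨x, y⟩
    simpa [FreeMonoid.reverse_mul, dual_toFun, FreeMonoid.reverse_of] using
      RightRel.mk (f := f.dual) x y

theorem dual_rightReverses_iff (w w' : SignedWord S) :
    f.dual.RightReverses w w' ↔ f.LeftReverses w.reverse w'.reverse := by
  constructor
  · refine Relation.ReflTransGen.lift FreeMonoid.reverse ?_ _ _
    rintro _ _ ⟨p, q, x, y⟩
    simpa [FreeMonoid.reverse_mul, reverse_posWord, reverse_negWord, FreeMonoid.reverse_of, dual_toFun,
      Function.onFun, FreeMonoid.reverse_reverse, mul_assoc] using LeftStep.mk (f := f) q.reverse p.reverse x y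
  · intro h
    rw [← FreeMonoid.reverse_reverse (a := w), ← FreeMonoid.reverse_reverse (a := w')]
    refine Relation.ReflTransGen.lift (p := f.dual.RightStep) FreeMonoid.reverse ?_ _ _ h
    rintro _ _ ⟨p, q, x, y⟩
    simpa [FreeMonoid.reverse_mul, reverse_posWord, reverse_negWord, FreeMonoid.reverse_of, dual_toFun,
      Function.onFun, mul_assoc] using RightStep.mk (f := f.dual) q.reverse p.reverse x y

/-- Reading backwards turns the result `c⁻¹ d` into one whose positive part comes from `d`;
exchanging `u` and `v` restores `c`. -/
theorem dual_isRightC_iff (u v c : FreeMonoid S) :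
    f.dual.IsRightC u v c ↔ f.IsLeftC v.reverse u.reverse c.reverse := by
  simp only [IsRightC, IsLeftC, dual_rightReverses_iff, FreeMonoid.reverse_mul, reverse_posWord,
    reverse_negWord]
  constructor
  · rintro ⟨d, hd⟩
    exact ⟨d.reverse, hd.swap⟩
  · rintro ⟨d, hd⟩
    exact ⟨d.reverse, by simpa [FreeMonoid.reverse_reverse] using hd.swap⟩

theorem dual_rightCoherent_iff : f.dual.RightCoherent ↔ f.LeftCoherent := by
  simp only [RightCoherent, LeftCoherent, dual_isRightC_iff, dual_rightEquiv_iff, dual_toFun,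
    FreeMonoid.reverse_reverse]
  constructor
  · intro h x y z c hc
    obtain ⟨c', hc', hcc⟩ := h x y z c.reverse (by rwa [FreeMonoid.reverse_reverse])
    exact ⟨c'.reverse, hc', by rwa [FreeMonoid.reverse_reverse] at hcc⟩
  · intro h x y z c hc
    obtain ⟨c', hc', hcc⟩ := h x y z c.reverse hc
    exact ⟨c'.reverse, by rwa [FreeMonoid.reverse_reverse],
      by rwa [FreeMonoid.reverse_reverse]⟩

theorem nonempty_mulEquiv_dual_rightMonoid_iff {M : Type u} [Monoid M] :
    Nonempty (M ≃* f.dual.RightMonoid) ↔ Nonempty (Mᵐᵒᵖ ≃* f.LeftMonoid) := by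
  rw [nonempty_mulEquiv_presentedMonoid_iff, nonempty_mulEquiv_presentedMonoid_iff]
  constructor
  · rintro ⟨π, hπ, h⟩
    have hop : ∀ u, FreeMonoid.lift (fun x => op (π (FreeMonoid.of x))) u = op (π u.reverse) := by
      intro u
      induction u using FreeMonoid.inductionOn' with
      | one => exact (congrArg op (map_one π)).symm
      | of_mul x u ih =>
        rw [map_mul, ih, FreeMonoid.reverse_mul, map_mul, op_mul, FreeMonoid.reverse_of]; rfl
    refine ⟨FreeMonoid.lift fun x => op (π (FreeMonoid.of x)), fun a => ?_, fun u v => ?_⟩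
    · obtain ⟨u, hu⟩ := hπ a.unop
      exact ⟨u.reverse, by rw [hop, FreeMonoid.reverse_reverse, hu, op_unop]⟩
    · rw [hop, hop, op_inj, h]
      have := f.dual_rightEquiv_iff u.reverse v.reverse
      rwa [FreeMonoid.reverse_reverse, FreeMonoid.reverse_reverse] at this
  · rintro ⟨π, hπ, h⟩
    have hop : ∀ u, FreeMonoid.lift (fun x => unop (π (FreeMonoid.of x))) u =
        unop (π u.reverse) := by
      intro u
      induction u using FreeMonoid.inductionOn' with
      | one => exact (congrArg unop (map_one π)).symm
      | of_mul x u ih =>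
        rw [map_mul, ih, FreeMonoid.reverse_mul, map_mul, unop_mul, FreeMonoid.reverse_of]; rfl
    refine ⟨FreeMonoid.lift fun x => unop (π (FreeMonoid.of x)), fun a => ?_, fun u v => ?_⟩
    · obtain ⟨u, hu⟩ := hπ (op a)
      exact ⟨u.reverse, by rw [hop, FreeMonoid.reverse_reverse, hu, unop_op]⟩
    · rw [hop, hop, unop_inj, h]
      exact (f.dual_rightEquiv_iff u v).symm

theorem exists_rightCoherent_iff {M : Type u} [Monoid M] :
    (∃ (S : Type u) (_ : Finite S) (g : WordComplement S),
      g.RightCoherent ∧ Nonempty (M ≃* g.RightMonoid)) ↔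
    ∃ (S : Type u) (_ : Finite S) (f : WordComplement S),
      f.LeftCoherent ∧ Nonempty (Mᵐᵒᵖ ≃* f.LeftMonoid) := by
  constructor
  · rintro ⟨S, hS, g, hg, e⟩
    rw [← dual_dual g] at hg e
    exact ⟨S, hS, g.dual, g.dual.dual_rightCoherent_iff.1 hg,
      g.dual.nonempty_mulEquiv_dual_rightMonoid_iff.1 e⟩
  · rintro ⟨S, hS, f, hf, e⟩
    exact ⟨S, hS, f.dual, f.dual_rightCoherent_iff.2 hf,
      f.nonempty_mulEquiv_dual_rightMonoid_iff.2 e⟩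

end WordComplement

section Opposite

variable {M : Type u} [Monoid M]

theorem leftLE_op {a b : M} : LeftLE (op a) (op b) ↔ RightLE a b := by
  constructor
  · rintro ⟨c, hc⟩
    exact ⟨c.unop, op_injective hc⟩
  · rintro ⟨c, rfl⟩
    exact ⟨op c, rfl⟩

theorem rightLE_op {a b : M} : RightLE (op a) (op b) ↔ LeftLE a b := by
  constructor
  · rintro ⟨c, hc⟩
    exact ⟨c.unop, op_injective hc⟩
  · rintro ⟨c, rfl⟩
    exact ⟨op c, rfl⟩

theorem leftDivisors_op (a : M) : leftDivisors (op a) = unop ⁻¹' rightDivisors a :=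
  Set.ext fun x => leftLE_op (a := x.unop)

theorem rightDivisors_op (a : M) : rightDivisors (op a) = unop ⁻¹' leftDivisors a :=
  Set.ext fun x => rightLE_op (a := x.unop)

theorem isAtomicMonoid_op (h : IsAtomicMonoid M) : IsAtomicMonoid Mᵐᵒᵖ := by
  obtain ⟨ν, hν⟩ := h
  exact ⟨fun a => ν a.unop, fun a => by simp [hν.eq_zero_iff],
    fun a b => by simpa [add_comm] using hν.add_le_mul b.unop a.unop⟩

theorem isLatticeRel_rightLE_iff :
    IsLatticeRel (RightLE (M := M)) ↔ IsLatticeRel (LeftLE (M := Mᵐᵒᵖ)) := by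
  constructor
  · rintro ⟨h₁, h₂, h₃, h₄, h₅⟩
    simp only [← leftLE_op] at h₁ h₂ h₃ h₄ h₅
    refine ⟨fun a => h₁ a.unop, fun a b c => h₂ a.unop b.unop c.unop,
      fun a b h h' => unop_injective (h₃ a.unop b.unop h h'), fun a b => ?_, fun a b => ?_⟩
    · obtain ⟨s, hs, hs', h⟩ := h₄ a.unop b.unop
      exact ⟨op s, hs, hs', fun c => h c.unop⟩
    · obtain ⟨s, hs, hs', h⟩ := h₅ a.unop b.unop
      exact ⟨op s, hs, hs', fun c => h c.unop⟩
  · rintro ⟨h₁, h₂, h₃, h₄, h₅⟩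
    constructor <;> simp only [← leftLE_op]
    · exact fun a => h₁ _
    · exact fun a b c => h₂ _ _ _
    · exact fun a b h h' => op_injective (h₃ _ _ h h')
    · intro a b
      obtain ⟨s, hs, hs', h⟩ := h₄ (op a) (op b)
      exact ⟨s.unop, hs, hs', fun c => h (op c)⟩
    · intro a b
      obtain ⟨s, hs, hs', h⟩ := h₅ (op a) (op b)
      exact ⟨s.unop, hs, hs', fun c => h (op c)⟩

theorem leftDivisors_op_eq_rightDivisors_op {Δ : M} (h : leftDivisors Δ = rightDivisors Δ) :
    leftDivisors (op Δ) = rightDivisors (op Δ) := by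
  rw [leftDivisors_op, rightDivisors_op, h]

theorem closure_leftDivisors_op {Δ : M} (h : leftDivisors Δ = rightDivisors Δ)
    (hΔ : Submonoid.closure (leftDivisors Δ) = ⊤) :
    Submonoid.closure (leftDivisors (op Δ)) = ⊤ := by
  rw [leftDivisors_op, ← h, ← Submonoid.op_closure, hΔ, Submonoid.op_top]

end Opposite

end Dual

/-! ### Atoms, powers of the Garside element, and the lattice order -/

section Generation

variable {M : Type u} [Monoid M]

theorem closure_eq_top_of_atoms (hM : IsAtomicMonoid M) {D : Set M}
    (hD : ∀ a, IsMonoidAtom a → a ∈ D) : Submonoid.closure D = ⊤ := by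
  obtain ⟨ν, hν⟩ := hM
  rw [Submonoid.eq_top_iff']
  intro a
  induction hn : ν a using Nat.strong_induction_on generalizing a with
  | _ n ih =>
    subst hn
    by_cases h1 : a = 1
    · exact h1 ▸ one_mem _
    by_cases ha : IsMonoidAtom a
    · exact Submonoid.subset_closure (hD a ha)
    obtain ⟨b, c, rfl, hb, hc⟩ : ∃ b c, a = b * c ∧ b ≠ 1 ∧ c ≠ 1 := by
      simpa [IsMonoidAtom, h1] using ha
    have := hν.add_le_mul b c
    have := hν.pos hb
    have := hν.pos hc
    exact mul_mem (ih (ν b) (by omega) b rfl) (ih (ν c) (by omega) c rfl)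

theorem IsMonoidAtom.mem_of_closure_eq_top {D : Set M} (hD : Submonoid.closure D = ⊤) {a : M}
    (ha : IsMonoidAtom a) : a ∈ D := by
  induction a using Submonoid.induction_of_closure_eq_top_left hD with
  | one => exact (ha.1 rfl).elim
  | mul_left x hx y ih =>
    obtain rfl | rfl := ha.2 x y rfl
    · rw [one_mul] at ha ⊢
      exact ih ha
    · rwa [mul_one]

/-- Divisors move across `Δ` without cancellation: if `y z = Δ`, then `z` also divides on the left,
say `z t = Δ`, whence `y Δ = y z t = Δ t`. -/
theorem exists_mul_pow_eq_pow_mul {Δ : M} (hΔ : leftDivisors Δ = rightDivisors Δ) (k : ℕ) {x : M}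
    (hx : LeftLE x Δ) : ∃ y, LeftLE y Δ ∧ x * Δ ^ k = Δ ^ k * y := by
  have hR : ∀ y, RightLE y Δ → LeftLE y Δ := fun y hy => hΔ.ge hy
  induction k with
  | zero => exact ⟨x, hx, by simp⟩
  | succ k ih =>
    obtain ⟨y, ⟨z, hz⟩, hy⟩ := ih
    obtain ⟨t, ht⟩ := hR z ⟨y, hz⟩
    exact ⟨t, hR t ⟨z, ht⟩, by rw [pow_succ, ← mul_assoc, hy, mul_assoc, mul_assoc, ← hz, mul_assoc,
      ht, hz]⟩

theorem exists_leftLE_pow {Δ : M} (hΔ : leftDivisors Δ = rightDivisors Δ)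
    (hgen : Submonoid.closure (leftDivisors Δ) = ⊤) (a : M) : ∃ k, LeftLE a (Δ ^ k) := by
  induction a using Submonoid.induction_of_closure_eq_top_left hgen with
  | one => exact ⟨0, 1, by simp⟩
  | mul_left x hx y ih =>
    obtain ⟨k, z, hz⟩ := ih
    obtain ⟨x', ⟨t, ht⟩, hx'⟩ := exists_mul_pow_eq_pow_mul hΔ k hx
    exact ⟨k + 1, z * t, by rw [← mul_assoc, mul_assoc x, hz, hx', mul_assoc, ht, pow_succ]⟩

theorem exists_common_right_multiple {Δ : M} (hΔ : leftDivisors Δ = rightDivisors Δ)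
    (hgen : Submonoid.closure (leftDivisors Δ) = ⊤) (a b : M) :
    ∃ m, LeftLE a m ∧ LeftLE b m := by
  obtain ⟨k, c, hc⟩ := exists_leftLE_pow hΔ hgen a
  obtain ⟨l, d, hd⟩ := exists_leftLE_pow hΔ hgen b
  exact ⟨Δ ^ (k + l), ⟨c * Δ ^ l, by rw [← mul_assoc, hc, pow_add]⟩,
    ⟨d * Δ ^ k, by rw [← mul_assoc, hd, add_comm, pow_add]⟩⟩

theorem leftLE_antisymm (hM : IsAtomicMonoid M) {a b : M} (h : LeftLE a b) (h' : LeftLE b a) :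
    a = b := by
  obtain ⟨ν, hν⟩ := hM
  obtain ⟨c, rfl⟩ := h
  obtain ⟨d, hd⟩ := h'
  have := hν.le_mul_right (a * c) d
  rw [hd] at this
  rw [hν.eq_one_of_mul_le this, mul_one]

/-- In an atomic monoid with least common right multiples, left divisibility is a lattice order. -/
theorem isLatticeRel_leftLE (hM : IsAtomicMonoid M)
    (hlub : ∀ a b : M, ∃ s, LeftLE a s ∧ LeftLE b s ∧ ∀ c, LeftLE a c → LeftLE b c → LeftLE s c) :
    IsLatticeRel (LeftLE (M := M)) where
  refl a := ⟨1, mul_one a⟩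
  trans := by
    rintro a _ _ ⟨c, rfl⟩ ⟨d, rfl⟩
    exact ⟨c * d, (mul_assoc _ _ _).symm⟩
  antisymm a b := leftLE_antisymm hM
  exists_lub := hlub
  exists_glb := by
    intro a b
    obtain ⟨ν, hν⟩ := hM
    -- Take a common divisor `i` of maximal norm. Its lcm `i d` with another common divisor is again
    -- a common divisor, so maximality forces `d = 1`.
    let P : ℕ → Prop := fun n => ∃ i, LeftLE i a ∧ LeftLE i b ∧ ν i = n
    have hP : ∀ n, P n → n ≤ ν a := by
      rintro _ ⟨i, ⟨c, rfl⟩, -, rfl⟩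
      exact hν.le_mul_right i c
    have hP0 : P 0 := ⟨1, ⟨a, one_mul a⟩, ⟨b, one_mul b⟩, (hν.eq_zero_iff 1).2 rfl⟩
    classical
    obtain ⟨i, hia, hib, hi⟩ := Nat.findGreatest_spec (P := P) (Nat.zero_le (ν a)) hP0
    refine ⟨i, hia, hib, fun c hca hcb => ?_⟩
    obtain ⟨s, ⟨d, rfl⟩, hcs, hs⟩ := hlub i c
    have hsP : P (ν (i * d)) := ⟨i * d, hs a hia hca, hs b hib hcb, rfl⟩
    have := Nat.le_findGreatest (hP _ hsP) hsP
    rw [← hi] at this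
    rwa [hν.eq_one_of_mul_le this, mul_one] at hcs

end Generation

/-- A coherent complement presenting an atomic monoid with common right multiples makes it left
cancellative, and makes left divisibility a lattice order. -/
theorem WordComplement.LeftCoherent.cancel_and_lattice {M S : Type u} [Monoid M]
    {f : WordComplement S} (hf : f.LeftCoherent) (hM : IsAtomicMonoid M)
    (e : M ≃* f.LeftMonoid) (hm : ∀ a b : M, ∃ m, LeftLE a m ∧ LeftLE b m) :
    IsLeftCancelMul M ∧ IsLatticeRel (LeftLE (M := M)) := by
  have hf' : IsAtomicMonoid f.LeftMonoid := by
    obtain ⟨ν, hν⟩ := hM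
    exact ⟨fun a => ν (e.symm a), fun a => by simp [hν.eq_zero_iff],
      fun a b => by simpa using hν.add_le_mul (e.symm a) (e.symm b)⟩
  have hle : ∀ a b, LeftLE (e a) (e b) ↔ LeftLE a b := by
    intro a b
    simp only [LeftLE, ← map_mul, e.injective.eq_iff, e.surjective.exists]
  refine ⟨⟨fun a b c h => e.injective (hf.mul_left_cancel hf' (a := e a) ?_)⟩,
    isLatticeRel_leftLE hM fun a b => ?_⟩
  · simpa only [map_mul] using congrArg e h
  · obtain ⟨m, ha, hb⟩ := hm a b
    obtain ⟨s, hs⟩ := hf.exists_lub hf' ((hle a m).2 ha) ((hle b m).2 hb)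
    obtain ⟨s, rfl⟩ := e.surjective s
    simp only [e.surjective.forall, hle] at hs
    exact ⟨s, hs⟩

theorem isGarsideMonoid_of_coherent {M : Type u} [Monoid M] (hfg : Monoid.FG M)
    (hM : IsAtomicMonoid M)
    (hL : ∃ (S : Type u) (_ : Finite S) (f : WordComplement S),
      f.LeftCoherent ∧ Nonempty (M ≃* f.LeftMonoid))
    (hR : ∃ (S : Type u) (_ : Finite S) (g : WordComplement S),
      g.RightCoherent ∧ Nonempty (M ≃* g.RightMonoid))
    {Δ : M} (hat : ∀ a : M, IsMonoidAtom a → LeftLE a Δ)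
    (hΔ : leftDivisors Δ = rightDivisors Δ) : IsGarsideMonoid M := by
  have hgen := closure_eq_top_of_atoms hM hat
  obtain ⟨S, -, f, hf, ⟨e⟩⟩ := hL
  obtain ⟨S', -, g, hg, ⟨e'⟩⟩ := WordComplement.exists_rightCoherent_iff.1 hR
  obtain ⟨hcL, hlL⟩ := hf.cancel_and_lattice hM e (exists_common_right_multiple hΔ hgen)
  obtain ⟨hcR, hlR⟩ := hg.cancel_and_lattice (isAtomicMonoid_op hM) e'
    (exists_common_right_multiple (leftDivisors_op_eq_rightDivisors_op hΔ)
      (closure_leftDivisors_op hΔ hgen))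
  exact
    { atomic := hM
      fg := hfg
      cancel :=
        { mul_left_cancel := hcL.mul_left_cancel
          mul_right_cancel := fun a b c h => MulOpposite.op_injective
            (hcR.mul_left_cancel (MulOpposite.op a) (congrArg MulOpposite.op h)) }
      left_lattice := hlL
      right_lattice := isLatticeRel_rightLE_iff.2 hlR
      exists_garside := ⟨Δ, hgen, hΔ⟩ }

/-! ### From a Garside monoid to coherent complements -/

theorem IsNorm.finite_le {M : Type u} [Monoid M] (hfg : Monoid.FG M) {ν : M → ℕ} (hν : IsNorm ν)
    (n : ℕ) : {a | ν a ≤ n}.Finite := by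
  obtain ⟨T, hT, hTf⟩ := (Monoid.fg_iff (M := M)).1 hfg
  induction n with
  | zero => exact (Set.finite_singleton 1).subset fun a ha => (hν.eq_zero_iff a).1 (by simpa using ha)
  | succ n ih =>
    refine ((Set.finite_singleton 1).union (hTf.image2 (· * ·) ih)).subset fun a ha => ?_
    induction a using Submonoid.induction_of_closure_eq_top_left hT with
    | one => exact Or.inl rfl
    | mul_left x hx y ihy =>
      by_cases h1 : x = 1
      · subst h1
        rw [one_mul] at ha ⊢
        exact ihy ha
      · exact Or.inr ⟨x, hx, y, Nat.le_of_lt_succ ((hν.lt_mul_left h1 y).trans_le ha), rfl⟩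

namespace IsLatticeRel

variable {M : Type u} [Monoid M] (hl : IsLatticeRel (LeftLE (M := M)))

/-- The least common right multiple of `a` and `b`. -/
noncomputable def lcm (a b : M) : M := (hl.exists_lub a b).choose

theorem le_lcm_left (a b : M) : LeftLE a (hl.lcm a b) := (hl.exists_lub a b).choose_spec.1

theorem le_lcm_right (a b : M) : LeftLE b (hl.lcm a b) := (hl.exists_lub a b).choose_spec.2.1

theorem lcm_le {a b c : M} (ha : LeftLE a c) (hb : LeftLE b c) : LeftLE (hl.lcm a b) c :=
  (hl.exists_lub a b).choose_spec.2.2 c ha hb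

theorem lcm_comm (a b : M) : hl.lcm a b = hl.lcm b a :=
  hl.antisymm _ _ (hl.lcm_le (hl.le_lcm_right b a) (hl.le_lcm_left b a))
    (hl.lcm_le (hl.le_lcm_right a b) (hl.le_lcm_left a b))

theorem lcm_eq_right {a b : M} (h : LeftLE a b) : hl.lcm a b = b :=
  hl.antisymm _ _ (hl.lcm_le h (hl.refl b)) (hl.le_lcm_right a b)

/-- The element that completes `a` to the least common right multiple of `a` and `b`. -/
noncomputable def compl (a b : M) : M := (hl.le_lcm_left a b).choose

theorem mul_compl (a b : M) : a * hl.compl a b = hl.lcm a b := (hl.le_lcm_left a b).choose_spec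

theorem mul_compl_comm (a b : M) : a * hl.compl a b = b * hl.compl b a := by
  rw [mul_compl, mul_compl, lcm_comm]

theorem compl_one_left (a : M) : hl.compl 1 a = a := by
  rw [← one_mul (hl.compl 1 a), mul_compl, hl.lcm_eq_right ⟨a, one_mul a⟩]

/-- As `a · compl a b` divides `Δ` on the left, `compl a b` starts a right divisor of `Δ`, which is
also a left divisor. -/
theorem compl_mem {Δ : M} (hΔ : leftDivisors Δ = rightDivisors Δ) {a b : M}
    (ha : a ∈ leftDivisors Δ) (hb : b ∈ leftDivisors Δ) : hl.compl a b ∈ leftDivisors Δ := by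
  obtain ⟨d, hd⟩ := hl.lcm_le ha hb
  rw [← mul_compl, mul_assoc] at hd
  obtain ⟨e, he⟩ : hl.compl a b * d ∈ leftDivisors Δ := hΔ.ge ⟨a, hd⟩
  exact ⟨d * e, by rw [← mul_assoc, he]⟩

section Cancel

variable [IsLeftCancelMul M]

theorem compl_eq_one {a b : M} (h : LeftLE b a) : hl.compl a b = 1 := by
  refine mul_left_cancel (a := a) ?_
  rw [mul_compl, lcm_comm, hl.lcm_eq_right h, mul_one]

theorem mul_lcm_compl_le {x y z m : M} (hx : LeftLE x m) (hy : LeftLE y m) (hz : LeftLE z m) :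
    LeftLE (x * hl.lcm (hl.compl x y) (hl.compl x z)) m := by
  obtain ⟨d, hd⟩ := hl.lcm_le hx hy
  obtain ⟨d', rfl⟩ := hl.lcm_le hx hz
  rw [← mul_compl, ← mul_compl, mul_assoc, mul_assoc] at hd
  obtain ⟨e, he⟩ := hl.lcm_le ⟨d, mul_left_cancel hd⟩ ⟨d', rfl⟩
  exact ⟨e, by rw [mul_assoc, he, ← mul_assoc, mul_compl]⟩

theorem mul_lcm_compl_comm (x y z : M) :
    x * hl.lcm (hl.compl x y) (hl.compl x z) = y * hl.lcm (hl.compl y x) (hl.compl y z) := by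
  have hle : ∀ x y z : M, LeftLE (x * hl.lcm (hl.compl x y) (hl.compl x z))
      (y * hl.lcm (hl.compl y x) (hl.compl y z)) := by
    intro x y z
    have hmul : ∀ {a b : M}, LeftLE a b → LeftLE (y * a) (y * b) := by
      rintro a _ ⟨c, rfl⟩
      exact ⟨c, mul_assoc _ _ _⟩
    have h₁ := hmul (hl.le_lcm_left (hl.compl y x) (hl.compl y z))
    have h₂ := hmul (hl.le_lcm_right (hl.compl y x) (hl.compl y z))
    rw [mul_compl] at h₁ h₂
    exact hl.mul_lcm_compl_le (hl.trans _ _ _ (hl.le_lcm_right y x) h₁) ⟨_, rfl⟩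
      (hl.trans _ _ _ (hl.le_lcm_right y z) h₂)
  exact hl.antisymm _ _ (hle x y z) (hle y x z)

/-- Multiplied on the left by `lcm(x,y)`, both sides give `lcm(x,y,z)`. -/
theorem compl_compl (x y z : M) : hl.compl (hl.compl x y) (hl.compl x z) =
    hl.compl (hl.compl y x) (hl.compl y z) := by
  refine mul_left_cancel (a := x * hl.compl x y) ?_
  rw [mul_assoc, mul_compl, mul_lcm_compl_comm, hl.mul_compl_comm x y, mul_assoc, mul_compl]

end Cancel

end IsLatticeRel

section LetterWord

variable {M : Type u} [Monoid M] (D : Set M)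

open Classical in
/-- The word of length at most one, on the nontrivial elements of `D`, that represents `a ∈ D`. -/
noncomputable def letterWord (a : M) : FreeMonoid {x : M // x ∈ D ∧ x ≠ 1} :=
  if h : a ∈ D ∧ a ≠ 1 then FreeMonoid.of ⟨a, h⟩ else 1

theorem letterWord_one : letterWord D 1 = 1 := dif_neg fun h => h.2 rfl

theorem letterWord_val (x : {x : M // x ∈ D ∧ x ≠ 1}) : letterWord D x.1 = FreeMonoid.of x :=
  dif_pos x.2

/-- The product in `M` of a word on the nontrivial elements of `D`. -/
def wordProd : FreeMonoid {x : M // x ∈ D ∧ x ≠ 1} →* M := FreeMonoid.lift Subtype.val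

@[simp] theorem wordProd_of (x : {x : M // x ∈ D ∧ x ≠ 1}) :
    wordProd D (FreeMonoid.of x) = x.1 := rfl

theorem wordProd_letterWord {a : M} (ha : a ∈ D) : wordProd D (letterWord D a) = a := by
  by_cases h : a = 1
  · rw [h, letterWord_one, map_one]
  · rw [letterWord, dif_pos ⟨ha, h⟩, wordProd_of]

theorem wordProd_surjective (hD : Submonoid.closure D = ⊤) : Function.Surjective (wordProd D) := by
  intro a
  induction a using Submonoid.induction_of_closure_eq_top_left hD with
  | one => exact ⟨1, map_one _⟩
  | mul_left x hx y ih =>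
    obtain ⟨u, rfl⟩ := ih
    exact ⟨letterWord D x * u, by rw [map_mul, wordProd_letterWord D hx]⟩

end LetterWord

namespace IsLatticeRel

variable {M : Type u} [Monoid M] [IsLeftCancelMul M] (hl : IsLatticeRel (LeftLE (M := M)))

/-- The complement on the nontrivial elements of `D` given by the least common right multiple. -/
noncomputable def lcmComplement (D : Set M) : WordComplement {x : M // x ∈ D ∧ x ≠ 1} where
  toFun x y := letterWord D (hl.compl x.1 y.1)
  self x := by rw [hl.compl_eq_one (hl.refl _), letterWord_one]

/-- Since complements of letters have length at most one, a single step suffices, or none if `a` or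
`b` is `1`. -/
theorem leftReverses_letterWord {Δ a b : M} (ha : a ∈ leftDivisors Δ) (hb : b ∈ leftDivisors Δ) :
    (hl.lcmComplement (leftDivisors Δ)).LeftReverses
      (negWord (letterWord (leftDivisors Δ) a) * posWord (letterWord (leftDivisors Δ) b))
      (posWord (letterWord (leftDivisors Δ) (hl.compl a b)) *
        negWord (letterWord (leftDivisors Δ) (hl.compl b a))) := by
  by_cases ha1 : a = 1
  · subst ha1
    rw [compl_one_left, hl.compl_eq_one ⟨b, one_mul b⟩, letterWord_one]
    simpa using .refl
  by_cases hb1 : b = 1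
  · subst hb1
    rw [compl_one_left, hl.compl_eq_one ⟨a, one_mul a⟩, letterWord_one]
    simpa using .refl
  have := (hl.lcmComplement (leftDivisors Δ)).leftReverses_letters ⟨a, ha, ha1⟩ ⟨b, hb, hb1⟩
  rwa [← posWord_of, ← negWord_of, ← letterWord_val, ← letterWord_val] at this

variable {Δ : M} (hΔ : leftDivisors Δ = rightDivisors Δ)
include hΔ

theorem leftCoherent_lcmComplement : (hl.lcmComplement (leftDivisors Δ)).LeftCoherent := by
  intro x y z c hc
  have hrev := fun x y z : {x : M // x ∈ leftDivisors Δ ∧ x ≠ 1} =>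
    hl.leftReverses_letterWord (hl.compl_mem hΔ x.2.1 y.2.1) (hl.compl_mem hΔ x.2.1 z.2.1)
  refine ⟨c, ?_, rfl⟩
  rw [hc.unique ⟨_, hrev x y z⟩, hl.compl_compl]
  exact ⟨_, hrev y x z⟩

/-- Completeness of the relations goes by induction on the norm: if `x u = y v` in `M`, this element
is `lcm(x,y)` times some word `w`. Cancelling the letters gives `u = f(x,y) w` and `v = f(y,x) w` in
`M`, at smaller norm, and one relation joins the two. -/
theorem wordProd_eq_iff (hM : IsAtomicMonoid M)
    (hgen : Submonoid.closure (leftDivisors Δ) = ⊤)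
    (u v : FreeMonoid {x : M // x ∈ leftDivisors Δ ∧ x ≠ 1}) :
    wordProd (leftDivisors Δ) u = wordProd (leftDivisors Δ) v ↔
      (hl.lcmComplement (leftDivisors Δ)).LeftEquiv u v := by
  obtain ⟨ν, hν⟩ := hM
  have hcompl := fun x y : {x : M // x ∈ leftDivisors Δ ∧ x ≠ 1} =>
    wordProd_letterWord _ (hl.compl_mem hΔ x.2.1 y.2.1)
  constructor
  · intro huv
    induction hn : ν (wordProd (leftDivisors Δ) u) using Nat.strong_induction_on
      generalizing u v with
    | _ n ih =>
      subst hn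
      have hne : ∀ x w, wordProd (leftDivisors Δ) (FreeMonoid.of x * w) ≠ 1 := by
        intro x w h
        have := hν.lt_mul_left x.2.2 (wordProd (leftDivisors Δ) w)
        rw [← wordProd_of, ← map_mul, h, (hν.eq_zero_iff 1).2 rfl] at this
        exact absurd this (Nat.not_lt_zero _)
      obtain rfl | ⟨x, u, rfl⟩ := eq_one_or_eq_of_mul u
      · obtain rfl | ⟨y, v, rfl⟩ := eq_one_or_eq_of_mul v
        · rfl
        · exact (hne y v (huv.symm.trans (map_one _))).elim
      obtain rfl | ⟨y, v, rfl⟩ := eq_one_or_eq_of_mul v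
      · exact (hne x u (huv.trans (map_one _))).elim
      simp only [map_mul, wordProd_of] at huv ih
      obtain ⟨d, hd⟩ := hl.lcm_le ⟨_, rfl⟩ ⟨_, huv.symm⟩
      obtain ⟨w, rfl⟩ := wordProd_surjective _ hgen d
      have hu : wordProd (leftDivisors Δ) u = wordProd (leftDivisors Δ)
          ((hl.lcmComplement (leftDivisors Δ)).toFun x y * w) := by
        refine mul_left_cancel (a := x.1) ?_
        rw [← hd, map_mul, lcmComplement, hcompl, ← mul_assoc, mul_compl]
      have hv : wordProd (leftDivisors Δ) v = wordProd (leftDivisors Δ)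
          ((hl.lcmComplement (leftDivisors Δ)).toFun y x * w) := by
        refine mul_left_cancel (a := y.1) ?_
        rw [← huv, ← hd, map_mul, lcmComplement, hcompl, ← mul_assoc, mul_compl, lcm_comm]
      have hu' := ih _ (hν.lt_mul_left x.2.2 _) _ _ hu rfl
      have hv' := ih _ (huv ▸ hν.lt_mul_left y.2.2 _) _ _ hv rfl
      unfold WordComplement.LeftEquiv at hu' hv' ⊢
      rw [map_mul, map_mul, hu', hv', map_mul, map_mul, ← mul_assoc, ← mul_assoc,
        WordComplement.leftMk_rel]
  · intro h
    have key : ∀ u v, ConGen.Rel (hl.lcmComplement (leftDivisors Δ)).LeftRel u v →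
        wordProd (leftDivisors Δ) u = wordProd (leftDivisors Δ) v := by
      intro u v h
      induction h with
      | of _ _ h =>
        obtain ⟨x, y⟩ := h
        rw [map_mul, map_mul, lcmComplement, hcompl, hcompl, wordProd_of, wordProd_of,
          mul_compl_comm]
      | refl => rfl
      | symm _ ih => exact ih.symm
      | trans _ _ ih ih' => exact ih.trans ih'
      | mul _ _ ih ih' => rw [map_mul, map_mul, ih, ih']
    exact key u v (PresentedMonoid.mk_eq_mk_iff.1 h)

end IsLatticeRel

theorem IsLatticeRel.exists_leftCoherent {M : Type u} [Monoid M] [IsLeftCancelMul M]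
    (hl : IsLatticeRel (LeftLE (M := M))) {Δ : M} (hΔ : leftDivisors Δ = rightDivisors Δ)
    (hfin : (leftDivisors Δ).Finite) (hM : IsAtomicMonoid M)
    (hgen : Submonoid.closure (leftDivisors Δ) = ⊤) :
    ∃ (S : Type u) (_ : Finite S) (f : WordComplement S),
      f.LeftCoherent ∧ Nonempty (M ≃* f.LeftMonoid) :=
  ⟨{x : M // x ∈ leftDivisors Δ ∧ x ≠ 1}, (hfin.subset fun _ h => h.1).to_subtype,
    hl.lcmComplement (leftDivisors Δ), hl.leftCoherent_lcmComplement hΔ,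
    nonempty_mulEquiv_presentedMonoid_iff.2
      ⟨_, wordProd_surjective _ hgen, hl.wordProd_eq_iff hΔ hM hgen⟩⟩

theorem finite_leftDivisors {M : Type u} [Monoid M] (hfg : Monoid.FG M) (hM : IsAtomicMonoid M)
    (a : M) : (leftDivisors a).Finite := by
  obtain ⟨ν, hν⟩ := hM
  refine (hν.finite_le hfg (ν a)).subset ?_
  rintro x ⟨c, rfl⟩
  exact hν.le_mul_right x c

end Garside

theorem mainTheorem7 (M : Type u) [Monoid M] :
    Garside.IsGarsideMonoid M ↔
      (Monoid.FG M ∧ Garside.IsAtomicMonoid M) ∧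
      ((∃ (S₁ : Type u) (_ : Finite S₁) (f : Garside.WordComplement S₁),
          f.LeftCoherent ∧ Nonempty (M ≃* f.LeftMonoid)) ∧
        (∃ (S₂ : Type u) (_ : Finite S₂) (g : Garside.WordComplement S₂),
          g.RightCoherent ∧ Nonempty (M ≃* g.RightMonoid))) ∧
      (∃ Δ : M, (∀ a : M, Garside.IsMonoidAtom a → Garside.LeftLE a Δ) ∧
        Garside.leftDivisors Δ = Garside.rightDivisors Δ) := by
  constructor
  · rintro ⟨hM, hfg, hc, hlL, hlR, Δ, hgen, hΔ⟩
    have hfin := Garside.finite_leftDivisors hfg hM Δ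
    refine ⟨⟨hfg, hM⟩, ⟨hlL.exists_leftCoherent hΔ hfin hM hgen, ?_⟩,
      Δ, fun a ha => ha.mem_of_closure_eq_top hgen, hΔ⟩
    refine Garside.WordComplement.exists_rightCoherent_iff.2 <|
      (Garside.isLatticeRel_rightLE_iff.1 hlR).exists_leftCoherent
        (Garside.leftDivisors_op_eq_rightDivisors_op hΔ) ?_ (Garside.isAtomicMonoid_op hM)
        (Garside.closure_leftDivisors_op hΔ hgen)
    rw [Garside.leftDivisors_op, ← hΔ]
    exact hfin.preimage MulOpposite.unop_injective.injOn
  · rintro ⟨⟨hfg, hM⟩, ⟨hL, hR⟩, Δ, hat, hΔ⟩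
    exact Garside.isGarsideMonoid_of_coherent hfg hM hL hR hat hΔ
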